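/- **Model.** Let $k\ge 1$. Agents $r_1,\dots,r_k$ with energies $e_1,\dots,e_k\ge 0$ are initially located at positions $0\le s_1\le s_2\le\cdots\le s_k\le 1$ of the segment $[0,1]$. Moving a distance $x$ costs an agent exactly $x$ units of its energy. When two different agents are at the same point, one of them, with current energy $e'$, may transfer any amount $0<x\le e'$ to the other. A *trajectory* of an agent is a finite walk in $[0,1]$ made of straight pieces, starting at its initial position, together with a schedule of energy transfers, i.e. the points of the walk at which it gives energy to or receives energy from a specified other agent, with the amounts. A set of trajectories (one for each of $r_1,\dots,r_k$) is *valid* if the moves and transfers can be ordered on a time line so that every transfer given by $r_i$ to $r_j$ is matched by the same transfer received by $r_j$ from $r_i$ while both are at the same point, every agent follows its whole trajectory, and no agent ever moves further, or gives more, than its current energy allows. It *explores* $[0,1]$ if every point of $[0,1]$ is visited by some agent. **Procedure.** Add a dummy agent $r_{k+1}$ with $s_{k+1}=1$, $e_{k+1}=0$. For $1\le i\le k$ the procedure $\mathrm{PATH}(i,\ell_i,tr_i)$ computes $\ell_{i+1}$ and $tr_{i+1}$ as follows. 1. If $tr_i\le 0$, let $d=s_i-\ell_i$. * (1.1) If $e_i<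 d+|tr_i|$, put $\ell_{i+1}=s_i$ and $tr_{i+1}=e_i+tr_i-d$. * (1.2) Otherwise let $e'=e_i-|tr_i|$ and $g=s_{i+1}-s_i$, and put $(y,L)=\bigl(\min\{\tfrac{e'-d}{2},g\},\,2y+d\bigr)$ if $e'\le 3d$; $(y,L)=(g,\,2y+d)$ if $e'>3d$ and $d\ge g$; $(y,L)=\bigl(\min\{e'-2d,g\},\,2d+y\bigr)$ if $e'>3d$ and $d<g$. Then $\ell_{i+1}=s_i+y$ and $tr_{i+1}=e_i+tr_i-L$. 2. If $tr_i>0$, let $y=\min\{s_{i+1}-s_i,\;e_i+tr_i\}$ and put $\ell_{i+1}=s_i+y$, $tr_{i+1}=tr_i+e_i-y$. If $i<k$, it then calls $\mathrm{PATH}(i+1,\ell_{i+1},tr_{i+1})$. If $i=k$, it returns **solvable** $=$ false when $\ell_{k+1}<1$ or $tr_{k+1}<0$, and **solvable** $=$ true otherwise. **Theorem.** There is an absolute constant $C$ such that for every $k\ge1$ and every such instance, the call $\mathrm{PATH}(1,0,0)$ terminates within $Ck$ steps (counting every arithmetic operation, constant, variable or array access, comparison, assignment, branching, call and return as one step, with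 exact real arithmetic), and it returns **solvable** $=$ true if and only if there is a valid set of trajectories of the agents $r_1,\dots,r_k$ that explores $[0,1]$. -/

import Mathlib

namespace SegmentExploration

/-! ### Agents, trajectories, validity, exploration -/

/-- One item of the trajectory of an agent: a straight move to the point `q`, or an item of its
schedule of energy transfers (hand the amount `x` to agent `j`, or get the amount `x` from agent
`j`), performed at the point of the walk that the agent has reached. -/
inductive Action (k : ℕ) : Type
  | move (q : ℝ)
  | give (j : Fin k) (x : ℝ)
  | receive (j : Fin k) (x : ℝ)

/-- A trajectory: a finite walk made of straight pieces, together with its schedule of energy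
transfers. The walk starts at the initial position of the agent. -/
abbrev Trajectory (k : ℕ) : Type := List (Action k)

/-- The points visited by an agent that starts at `p` and follows a trajectory. -/
def visited {k : ℕ} (p : ℝ) : Trajectory k → Set ℝ
  | [] => {p}
  | Action.move q :: t => Set.uIcc p q ∪ visited q t
  | Action.give _ _ :: t => visited p t
  | Action.receive _ _ :: t => visited p t

/-- Current positions, current energy levels, and the parts of the trajectories still to be
followed. -/
structure Config (k : ℕ) : Type where
  pos : Fin k → ℝ
  energy : Fin k → ℝ
  todo : Fin k → Trajectory k

/-- The next event on the time line. Either an agent performs the next straight move of its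
trajectory, inside `[0,1]`, for which its energy must suffice; or two distinct agents at the same
point perform a transfer that is the next item of both of their trajectories. Agents can stop and
wait, so only the order of the events on the time line matters. -/
inductive Step {k : ℕ} : Config k → Config k → Prop
  | move (c : Config k) (i : Fin k) (q : ℝ) (rest : Trajectory k)
      (htodo : c.todo i = Action.move q :: rest)
      (hq : q ∈ Set.Icc (0 : ℝ) 1)
      (henergy : |q - c.pos i| ≤ c.energy i) :
      Step c
        { pos := Function.update c.pos i q
          energy := Function.update c.energy i (c.energy i - |q - c.pos i|)
          todo := Function.update c.todo i rest }
  | transfer (c : Config k) (i j : Fin k) (x : ℝ) (resti restj : Trajectory k)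
      (hij : i ≠ j)
      (htodoi : c.todo i = Action.give j x :: resti)
      (htodoj : c.todo j = Action.receive i x :: restj)
      (hmeet : c.pos i = c.pos j)
      (hx : 0 < x)
      (henergy : x ≤ c.energy i) :
      Step c
        { pos := c.pos
          energy := Function.update (Function.update c.energy i (c.energy i - x)) j
            (c.energy j + x)
          todo := Function.update (Function.update c.todo i resti) j restj }

/-- A set of trajectories (one per agent) is valid for agents with initial positions `s` and
initial energies `e` if its moves and matching transfers can be put on a time line so that every
agent follows its trajectory to the end. -/
def Valid {k : ℕ} (s e : Fin k → ℝ) (T : Fin k → Trajectory k) : Prop :=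
  ∃ c : Config k, Relation.ReflTransGen Step ⟨s, e, T⟩ c ∧ ∀ i, c.todo i = []

/-- The trajectories explore the segment `[0,1]`. -/
def Explores {k : ℕ} (s : Fin k → ℝ) (T : Fin k → Trajectory k) : Prop :=
  Set.Icc (0 : ℝ) 1 ⊆ ⋃ i, visited (s i) (T i)

/-! ### A unit-cost language for tail-recursive procedures on real numbers

A procedure has an index parameter `i`, two real parameters (`l` and `tr`), and further local real
variables. It can read the entries `i` and `i + 1` of its input arrays. Every arithmetic operation,
constant, variable or array access, comparison, assignment, branching, call and return costs one
unit of time. -/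

/-- Real variables of the procedure. -/
inductive Var : Type
  | l | tr | nextL | nextTr | avail | d | g | y | len
  deriving DecidableEq

/-- Real-valued expressions; `energy` is `e_i`, `pos` is `s_i`, `posNext` is `s_{i+1}`. -/
inductive RealExpr : Type
  | const (n : ℕ)
  | var (v : Var)
  | energy
  | pos
  | posNext
  | add (a b : RealExpr)
  | sub (a b : RealExpr)
  | mul (a b : RealExpr)
  | div (a b : RealExpr)
  | min (a b : RealExpr)

/-- Tests; `idxLt` is the test `i < k`. -/
inductive Test : Type
  | le (a b : RealExpr)
  | lt (a b : RealExpr)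
  | or (p q : Test)
  | idxLt

/-- Commands; `call a b` is the tail call of the procedure itself with arguments `(i + 1, a, b)`,
and `ret r` returns the answer `r`. -/
inductive Cmd : Type
  | assign (v : Var) (a : RealExpr)
  | seq (c₁ c₂ : Cmd)
  | ite (p : Test) (c₁ c₂ : Cmd)
  | call (a b : RealExpr)
  | ret (r : Bool)

/-- The input: positions and energies of the agents `r_1, …, r_{k+1}`. -/
structure Input (k : ℕ) : Type where
  pos : Fin (k + 1) → ℝ
  energy : Fin (k + 1) → ℝ

/-- The entry number `j` (counted from `1`) of an array; entries out of range read as `0`. -/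
def entry {n : ℕ} (a : Fin n → ℝ) (j : ℕ) : ℝ :=
  if h : 1 ≤ j ∧ j ≤ n then a ⟨j - 1, by omega⟩ else 0

/-- The value of an expression during the invocation with index `i`. -/
noncomputable def RealExpr.eval {k : ℕ} (I : Input k) (i : ℕ) (σ : Var → ℝ) : RealExpr → ℝ
  | .const n => n
  | .var v => σ v
  | .energy => entry I.energy i
  | .pos => entry I.pos i
  | .posNext => entry I.pos (i + 1)
  | .add a b => a.eval I i σ + b.eval I i σ
  | .sub a b => a.eval I i σ - b.eval I i σ
  | .mul a b => a.eval I i σ * b.eval I i σ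
  | .div a b => a.eval I i σ / b.eval I i σ
  | .min a b => Min.min (a.eval I i σ) (b.eval I i σ)

/-- The time for evaluating an expression (`posNext` also computes the index `i + 1`). -/
def RealExpr.time : RealExpr → ℕ
  | .const _ => 1
  | .var _ => 1
  | .energy => 1
  | .pos => 1
  | .posNext => 2
  | .add a b => a.time + b.time + 1
  | .sub a b => a.time + b.time + 1
  | .mul a b => a.time + b.time + 1
  | .div a b => a.time + b.time + 1
  | .min a b => a.time + b.time + 1

/-- The truth value of a test. -/
def Test.Holds {k : ℕ} (I : Input k) (i : ℕ) (σ : Var → ℝ) : Test → Prop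
  | .le a b => a.eval I i σ ≤ b.eval I i σ
  | .lt a b => a.eval I i σ < b.eval I i σ
  | .or p q => p.Holds I i σ ∨ q.Holds I i σ
  | .idxLt => i < k

/-- The time for evaluating a test. -/
def Test.time : Test → ℕ
  | .le a b => a.time + b.time + 1
  | .lt a b => a.time + b.time + 1
  | .or p q => p.time + q.time + 1
  | .idxLt => 1

/-- How the execution of a command ends: it falls through with new values of the variables, or it
calls the procedure with real arguments `a`, `b`, or it returns an answer. -/
inductive Outcome : Type
  | next (σ : Var → ℝ)
  | call (a b : ℝ)
  | ret (r : Bool)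

open Classical in
/-- Execution of a command: the outcome and the time used. -/
noncomputable def Cmd.exec {k : ℕ} (I : Input k) (i : ℕ) : Cmd → (Var → ℝ) → Outcome × ℕ
  | .assign v a, σ => (.next (Function.update σ v (a.eval I i σ)), a.time + 1)
  | .seq c₁ c₂, σ =>
      match c₁.exec I i σ with
      | (.next σ', t) => ((c₂.exec I i σ').1, t + (c₂.exec I i σ').2)
      | (o, t) => (o, t)
  | .ite p c₁ c₂, σ =>
      if p.Holds I i σ then ((c₁.exec I i σ).1, p.time + 1 + (c₁.exec I i σ).2)
      else ((c₂.exec I i σ).1, p.time + 1 + (c₂.exec I i σ).2)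
  | .call a b, σ => (.call (a.eval I i σ) (b.eval I i σ), a.time + b.time + 2)
  | .ret r, _ => (.ret r, 1)

/-- The variables at the start of an invocation with real arguments `a`, `b`. -/
def initStore (a b : ℝ) : Var → ℝ
  | .l => a
  | .tr => b
  | _ => 0

/-- `Returns body I i a b r t`: the call with arguments `(i, a, b)` of the procedure with the given
body, on input `I`, terminates with answer `r` after exactly `t` units of time. -/
inductive Returns {k : ℕ} (body : Cmd) (I : Input k) : ℕ → ℝ → ℝ → Bool → ℕ → Prop
  | ret (i : ℕ) (a b : ℝ) (r : Bool) (t : ℕ)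
      (h : body.exec I i (initStore a b) = (.ret r, t)) :
      Returns body I i a b r t
  | call (i : ℕ) (a b a' b' : ℝ) (r : Bool) (t t' : ℕ)
      (h : body.exec I i (initStore a b) = (.call a' b', t))
      (h' : Returns body I (i + 1) a' b' r t') :
      Returns body I i a b r (t + t')

/-! ### The procedure `PATH(i, ℓ_i, tr_i)` -/

section Path

open RealExpr Var

/-- Case 1.1, `tr_i ≤ 0` and `e_i < s_i - ℓ_i + |tr_i|` (the deficit increases): agent `r_i` goes
from `s_i` to `ℓ_i`. -/
def deficitCase : Cmd :=
  .seq (.assign nextL pos)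
    (.assign nextTr (sub (add energy (var tr)) (sub pos (var l))))

/-- Case 1.2, `tr_i ≤ 0` and `e_i ≥ s_i - ℓ_i + |tr_i|` (the deficit is eliminated): with
`avail = e_i - |tr_i|`, `d = s_i - ℓ_i` and `g = s_{i+1} - s_i`, the trajectory of `r_i` covers
`[ℓ_i, s_i + y]` and has length `len`.
If `avail ≤ 3 d`, or else if `d ≥ g`, it goes from `s_i` right to `s_i + y` and back left to `ℓ_i`;
otherwise it goes from `s_i` left to `ℓ_i` and back right to `s_i + y`. -/
def balancedCase : Cmd :=
  .seq (.assign avail (add energy (var tr))) <|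
  .seq (.assign d (sub pos (var l))) <|
  .seq (.assign g (sub posNext pos)) <|
  .seq
    (.ite (.le (var avail) (mul (const 3) (var d)))
      (.seq (.assign y (min (div (sub (var avail) (var d)) (const 2)) (var g)))
        (.assign len (add (mul (const 2) (var y)) (var d))))
      (.ite (.le (var g) (var d))
        (.seq (.assign y (var g))
          (.assign len (add (mul (const 2) (var y)) (var d))))
        (.seq (.assign y (min (sub (var avail) (mul (const 2) (var d))) (var g)))
          (.assign len (add (mul (const 2) (var d)) (var y)))))) <|
  .seq (.assign nextTr (sub (add energy (var tr)) (var len)))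
    (.assign nextL (add pos (var y)))

/-- Case 2, `tr_i > 0` (energy surplus): agent `r_i` goes from `s_i` to the right until it runs out
of energy or reaches `s_{i+1}`. -/
def surplusCase : Cmd :=
  .seq (.assign y (min (sub posNext pos) (add energy (var tr)))) <|
  .seq (.assign nextL (add pos (var y)))
    (.assign nextTr (sub (add (var tr) energy) (var y)))

/-- The body of `PATH(i, ℓ_i, tr_i)`. -/
def pathBody : Cmd :=
  .seq
    (.ite (.le (var tr) (const 0))
      (.ite (.lt energy (sub (sub pos (var l)) (var tr))) deficitCase balancedCase)
      surplusCase)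
    (.ite .idxLt
      (.call (var nextL) (var nextTr))
      (.ite (.or (.lt (var nextL) (const 1)) (.lt (var nextTr) (const 0)))
        (.ret false)
        (.ret true)))

end Path

/-- The instance consisting of the agents `r_1, …, r_k` and a dummy agent `r_{k+1}` with zero energy
at position `1`. -/
def withDummy {k : ℕ} (s e : Fin k → ℝ) : Input k where
  pos := Fin.snoc (α := fun _ => ℝ) s 1
  energy := Fin.snoc (α := fun _ => ℝ) e 0

end SegmentExploration

/-!
In every exploring run, the distance covered beyond `ℓ_j` plus the energy finally left there is at
most `tr_j` plus the initial energy of the agents from number `j` on. To pass from `j` to `j + 1`,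
integrate the number of crossings: every point is crossed at least once. If on each side of the home
of the new agent some point were crossed only once, then the left one would be crossed leftwards,
because the energy to its right does not suffice. Hence the right one is never crossed rightwards,
and all energy beyond it comes from the later agents, which is the assertion for `j + 1`. Otherwise
the whole stretch on one side is covered twice, and the procedure chooses the cheaper side. The
energy balance behind this is that the energy held to the right of a point drops by the distance
travelled there, and that it crosses the point only by being carried.

Conversely, each pair `(ℓ_j, tr_j)` is realized by a tour of the first `j` agents, which is built
from the tour of the first `j - 1` agents by a detour of the new agent to the place where they wait.
-/

namespace SegmentExploration

open MeasureTheory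

/-! ### Crossings and distances along a trajectory -/

section Trajectories

variable {k : ℕ}

/-- The sum of `f a b` over the straight pieces, from `a` to `b`, of a walk that starts at `p`. -/
def sumPieces {M : Type*} [AddMonoid M] (f : ℝ → ℝ → M) (p : ℝ) : Trajectory k → M
  | [] => 0
  | Action.move q :: t => f p q + sumPieces f q t
  | Action.give _ _ :: t => sumPieces f p t
  | Action.receive _ _ :: t => sumPieces f p t

/-- The last point of a walk that starts at `p`. -/
def endpoint (p : ℝ) : Trajectory k → ℝ
  | [] => p
  | Action.move q :: t => endpoint q t
  | Action.give _ _ :: t => endpoint p t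
  | Action.receive _ _ :: t => endpoint p t

/-- The number of times (`0` or `1`) that a straight piece from `a` to `b` crosses `x` to the right.
A point counts as being to the right of itself. -/
noncomputable def crossRight (x a b : ℝ) : ℕ := if a < x ∧ x ≤ b then 1 else 0

/-- The number of times that a walk from `p` crosses `x` to the right. -/
noncomputable def rightCrossings (x p : ℝ) (t : Trajectory k) : ℕ :=
  sumPieces (crossRight x) p t

/-- The number of times that a walk from `p` crosses `x` to the left. -/
noncomputable def leftCrossings (x p : ℝ) (t : Trajectory k) : ℕ :=
  sumPieces (fun a b => crossRight x b a) p t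

/-- The number of times that a walk from `p` crosses `x`. -/
noncomputable def crossings (x p : ℝ) (t : Trajectory k) : ℕ :=
  rightCrossings x p t + leftCrossings x p t

/-- The distance that a walk from `p` covers to the right of `x`. -/
noncomputable def travelBeyond (x p : ℝ) (t : Trajectory k) : ℝ :=
  sumPieces (fun a b => |max b x - max a x|) p t

theorem crossRight_eq_zero_iff {x a b : ℝ} : crossRight x a b = 0 ↔ a < x → b < x := by
  simp [crossRight]

theorem crossRight_add_ite (x a b : ℝ) :
    crossRight x a b + (if x ≤ a then 1 else 0) =
      crossRight x b a + if x ≤ b then 1 else 0 := by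
  grind [crossRight]

theorem crossRight_add_crossRight (x a b : ℝ) :
    ((crossRight x a b + crossRight x b a : ℕ) : ℝ) =
      (Set.uIoc a b).indicator (fun _ => 1) x := by
  simp only [crossRight, Set.indicator, Set.mem_uIoc, Nat.cast_add, Nat.cast_ite, Nat.cast_one,
    Nat.cast_zero]
  grind

theorem crossings_move (x p q : ℝ) (t : Trajectory k) :
    crossings x p (Action.move q :: t) =
      (crossRight x p q + crossRight x q p) + crossings x q t := by
  simp only [crossings, rightCrossings, leftCrossings, sumPieces]
  ring

theorem rightCrossings_add_ite (x p : ℝ) (t : Trajectory k) :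
    rightCrossings x p t + (if x ≤ p then 1 else 0) =
      leftCrossings x p t + if x ≤ endpoint p t then 1 else 0 := by
  unfold rightCrossings leftCrossings
  fun_induction endpoint p t with
  | case1 p => rfl
  | case2 p q t ih =>
    have := crossRight_add_ite x p q
    simp only [sumPieces]
    omega
  | case3 _ _ _ _ ih => exact ih
  | case4 _ _ _ _ ih => exact ih

theorem lt_and_le_endpoint {x p : ℝ} {t : Trajectory k} (hcross : crossings x p t ≤ 1)
    (hright : rightCrossings x p t ≠ 0) : p < x ∧ x ≤ endpoint p t := by
  grind [crossings, rightCrossings_add_ite x p t]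

theorem endpoint_lt_and_le {x p : ℝ} {t : Trajectory k} (hcross : crossings x p t ≤ 1)
    (hleft : leftCrossings x p t ≠ 0) : endpoint p t < x ∧ x ≤ p := by
  grind [crossings, rightCrossings_add_ite x p t]

theorem le_endpoint_iff {x p : ℝ} {t : Trajectory k} (hcross : crossings x p t = 0) :
    x ≤ endpoint p t ↔ x ≤ p := by
  grind [crossings, rightCrossings_add_ite x p t]

theorem travelBeyond_nonneg (x p : ℝ) (t : Trajectory k) : 0 ≤ travelBeyond x p t := by
  unfold travelBeyond
  fun_induction endpoint p t with
  | case1 _ => exact le_rfl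
  | case2 p q t ih => exact add_nonneg (abs_nonneg _) ih
  | case3 _ _ _ _ ih => exact ih
  | case4 _ _ _ _ ih => exact ih

theorem le_iff_of_mem_visited {x p z : ℝ} {t : Trajectory k} (h : crossings x p t = 0)
    (hz : z ∈ visited p t) : x ≤ z ↔ x ≤ p := by
  fun_induction visited p t with
  | case1 p => rw [Set.mem_singleton_iff.1 hz]
  | case2 p q t ih =>
    simp only [crossings_move, Nat.add_eq_zero_iff, crossRight_eq_zero_iff] at h
    obtain ⟨⟨hright, hleft⟩, h⟩ := h
    rcases hz with hz | hz
    · rw [Set.mem_uIcc] at hz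
      grind
    · grind
  | case3 p j w t ih => exact ih h hz
  | case4 p j w t ih => exact ih h hz

theorem isClosed_visited (p : ℝ) (t : Trajectory k) : IsClosed (visited p t) := by
  fun_induction visited p t with
  | case1 p => exact isClosed_singleton
  | case2 p q t ih => exact isClosed_Icc.union ih
  | case3 _ _ _ _ ih => exact ih
  | case4 _ _ _ _ ih => exact ih

theorem integral_indicator_uIoc (a b : ℝ) {u v : ℝ} (huv : u ≤ v) :
    ∫ x in u..v, (Set.uIoc a b).indicator (fun _ => (1 : ℝ)) x =
      |max b u - max a u| - |max b v - max a v| := by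
  wlog hab : a ≤ b generalizing a b
  · rw [Set.uIoc_comm, this b a (le_of_not_ge hab), abs_sub_comm, abs_sub_comm (max a v)]
  rw [intervalIntegral.integral_of_le huv, setIntegral_indicator measurableSet_uIoc,
    Set.uIoc_of_le hab, Set.Ioc_inter_Ioc, setIntegral_const, Real.volume_real_Ioc, smul_eq_mul,
    mul_one, abs_of_nonneg (sub_nonneg.2 (max_le_max_right u hab)),
    abs_of_nonneg (sub_nonneg.2 (max_le_max_right v hab))]
  grind

theorem intervalIntegrable_indicator_uIoc (a b u v : ℝ) :
    IntervalIntegrable ((Set.uIoc a b).indicator fun _ => (1 : ℝ)) volume u v := by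
  rw [intervalIntegrable_iff]
  exact (integrableOn_const (by simp)).indicator measurableSet_uIoc

theorem intervalIntegrable_crossings (p : ℝ) (t : Trajectory k) (u v : ℝ) :
    IntervalIntegrable (fun x => (crossings x p t : ℝ)) volume u v := by
  fun_induction endpoint p t with
  | case1 p => simp [crossings, rightCrossings, leftCrossings, sumPieces]
  | case2 p q t ih =>
    simp only [crossings_move, Nat.cast_add _ (crossings _ _ _), crossRight_add_crossRight]
    exact (intervalIntegrable_indicator_uIoc p q u v).add ih
  | case3 _ _ _ _ ih => exact ih
  | case4 _ _ _ _ ih => exact ih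

theorem integral_crossings (p : ℝ) (t : Trajectory k) {u v : ℝ} (huv : u ≤ v) :
    ∫ x in u..v, (crossings x p t : ℝ) = travelBeyond u p t - travelBeyond v p t := by
  fun_induction endpoint p t with
  | case1 p => simp [crossings, rightCrossings, leftCrossings, travelBeyond, sumPieces]
  | case2 p q t ih =>
    simp only [crossings_move, Nat.cast_add _ (crossings _ _ _), crossRight_add_crossRight]
    rw [intervalIntegral.integral_add (intervalIntegrable_indicator_uIoc p q u v)
      (intervalIntegrable_crossings q t u v), integral_indicator_uIoc p q huv, ih]
    simp only [travelBeyond, sumPieces]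
    ring
  | case3 _ _ _ _ ih => exact ih
  | case4 _ _ _ _ ih => exact ih

end Trajectories

section Families

variable {k : ℕ} {s : Fin k → ℝ} {T : Fin k → Trajectory k}

/-- The number of times that the agents, starting at `s`, together cross `x`. -/
noncomputable def totalCrossings (s : Fin k → ℝ) (T : Fin k → Trajectory k) (x : ℝ) : ℕ :=
  ∑ i, crossings x (s i) (T i)

/-- The distance that the agents, starting at `s`, together cover to the right of `x`. -/
noncomputable def totalTravelBeyond (s : Fin k → ℝ) (T : Fin k → Trajectory k) (x : ℝ) : ℝ :=
  ∑ i, travelBeyond x (s i) (T i)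

theorem totalTravelBeyond_nonneg (s : Fin k → ℝ) (T : Fin k → Trajectory k) (x : ℝ) :
    0 ≤ totalTravelBeyond s T x :=
  Finset.sum_nonneg fun _ _ => travelBeyond_nonneg _ _ _

theorem mul_sub_le_totalTravelBeyond {m : ℕ} {u v : ℝ} (huv : u ≤ v)
    (hm : ∀ x ∈ Set.Ioo u v, m ≤ totalCrossings s T x) :
    m * (v - u) ≤ totalTravelBeyond s T u - totalTravelBeyond s T v := by
  have hintegrable (i : Fin k) := intervalIntegrable_crossings (s i) (T i) u v
  calc m * (v - u) = ∫ _ in u..v, (m : ℝ) := by simp [mul_comm]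
    _ ≤ ∫ x in u..v, ∑ i, (crossings x (s i) (T i) : ℝ) := by
      refine intervalIntegral.integral_mono_on_of_le_Ioo huv intervalIntegrable_const
        (by simpa only [Finset.sum_fn] using IntervalIntegrable.sum Finset.univ fun i _ =>
          hintegrable i) fun x hx => ?_
      exact_mod_cast hm x hx
    _ = totalTravelBeyond s T u - totalTravelBeyond s T v := by
      rw [intervalIntegral.integral_finsetSum fun i _ => hintegrable i]
      simp only [integral_crossings _ _ huv, Finset.sum_sub_distrib, totalTravelBeyond]

theorem Explores.one_le_totalCrossings (hexp : Explores s T) {x : ℝ} (hx : x ∈ Set.Ioc 0 1) :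
    1 ≤ totalCrossings s T x := by
  by_contra! h
  have hside (i : Fin k) {z : ℝ} (hz : z ∈ visited (s i) (T i)) : x ≤ z ↔ x ≤ s i :=
    le_iff_of_mem_visited (Finset.sum_eq_zero_iff.1 (Nat.lt_one_iff.1 h) i (Finset.mem_univ i)) hz
  -- The agents that start to the left of `x` visit all of `[0, x)`, hence also `x`.
  have hclosed : IsClosed (⋃ i ∈ {i | s i < x}, visited (s i) (T i)) :=
    (Set.toFinite _).isClosed_biUnion fun i _ => isClosed_visited _ _
  have hleft : Set.Ico 0 x ⊆ ⋃ i ∈ {i | s i < x}, visited (s i) (T i) := fun z hz => by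
    obtain ⟨i, hi⟩ := Set.mem_iUnion.1 (hexp ⟨hz.1, hz.2.le.trans hx.2⟩)
    exact Set.mem_biUnion (not_le.1 fun hsi => hz.2.not_ge ((hside i hi).2 hsi)) hi
  have hmem : x ∈ closure (Set.Ico 0 x) := by
    rw [closure_Ico hx.1.ne]
    exact ⟨hx.1.le, le_rfl⟩
  obtain ⟨i, hi, hxi⟩ := Set.mem_iUnion₂.1 (closure_minimal hleft hclosed hmem)
  exact not_le.2 hi ((hside i hxi).1 le_rfl)

theorem Explores.sub_le_totalTravelBeyond (hexp : Explores s T) {u v : ℝ} (hu : 0 ≤ u)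
    (huv : u ≤ v) (hv : v ≤ 1) : v - u ≤ totalTravelBeyond s T u - totalTravelBeyond s T v := by
  simpa using mul_sub_le_totalTravelBeyond (m := 1) huv fun x hx =>
    hexp.one_le_totalCrossings ⟨hu.trans_lt hx.1, hx.2.le.trans hv⟩

theorem crossings_le_totalCrossings (a : Fin k) (x : ℝ) :
    crossings x (s a) (T a) ≤ totalCrossings s T x :=
  Finset.single_le_sum (f := fun i => crossings x (s i) (T i)) (fun _ _ => Nat.zero_le _)
    (Finset.mem_univ a)

theorem crossings_add_le_totalCrossings {a b : Fin k} (hab : a ≠ b) (x : ℝ) :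
    crossings x (s a) (T a) + crossings x (s b) (T b) ≤ totalCrossings s T x := by
  rw [← Finset.sum_pair hab (f := fun i => crossings x (s i) (T i))]
  exact Finset.sum_le_sum_of_subset (Finset.subset_univ _)

/-- Were `x'` crossed to the right, then by agent `i`, which starts between `x` and `x'`; the agent
that crosses `x` to the left would then start beyond `x'` and be the second one to cross `x'`. -/
theorem rightCrossings_eq_zero_of_totalCrossings_le_one {i : Fin k} {x x' : ℝ} (hxx' : x < x')
    (hprev : ∀ m < i, s m < x) (hnext : ∀ m, i < m → x' ≤ s m)
    (hx : totalCrossings s T x ≤ 1) (hx' : totalCrossings s T x' ≤ 1)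
    (hleft : ∃ a, leftCrossings x (s a) (T a) ≠ 0) (b : Fin k) :
    rightCrossings x' (s b) (T b) = 0 := by
  by_contra hb
  obtain ⟨a, ha⟩ := hleft
  have ha_cross : crossings x (s a) (T a) ≠ 0 := by grind [crossings]
  have hb_cross : crossings x' (s b) (T b) ≠ 0 := by grind [crossings]
  obtain ⟨ha_end, ha_start⟩ := endpoint_lt_and_le ((crossings_le_totalCrossings a x).trans hx) ha
  obtain ⟨hb_start, hb_end⟩ := lt_and_le_endpoint ((crossings_le_totalCrossings b x').trans hx') hb
  have hab : a ≠ b := by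
    rintro rfl
    linarith
  have hb_cross_x : crossings x (s b) (T b) = 0 := by
    have := crossings_add_le_totalCrossings (s := s) (T := T) hab x
    omega
  have hbx : x ≤ s b := (le_endpoint_iff hb_cross_x).1 (by linarith)
  have hbi : b = i := le_antisymm (not_lt.1 fun h => (hnext b h).not_gt hb_start)
    (not_lt.1 fun h => (hprev b h).not_ge hbx)
  have hia : i < a := lt_of_le_of_ne (not_lt.1 fun h => (hprev a h).not_ge ha_start)
    (hbi ▸ hab.symm)
  have ha_cross_x' : crossings x' (s a) (T a) = 0 := by
    have := crossings_add_le_totalCrossings (s := s) (T := T) hab x'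
    omega
  have := (le_endpoint_iff ha_cross_x').2 (hnext a hia)
  linarith

end Families

/-! ### The energy balance of a run -/

section Runs

variable {k : ℕ} {c c' : Config k}

/-- The energy held by the agents at positions `≥ x`. -/
noncomputable def energyFrom {ι : Type*} [Fintype ι] (pos en : ι → ℝ) (x : ℝ) : ℝ :=
  ∑ i, if x ≤ pos i then en i else 0

theorem energyFrom_anti {ι : Type*} [Fintype ι] {pos en : ι → ℝ} (h : ∀ i, 0 ≤ en i) :
    Antitone (energyFrom pos en) := fun x y hxy =>
  Finset.sum_le_sum fun i _ => by
    have := h i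
    split_ifs <;> linarith

theorem energyFrom_nonneg {ι : Type*} [Fintype ι] {pos en : ι → ℝ} (h : ∀ i, 0 ≤ en i) (x : ℝ) :
    0 ≤ energyFrom pos en x :=
  Finset.sum_nonneg fun i _ => ite_nonneg (h i) le_rfl

/-- The potential of the energy argument at `x`: the energy held to the right of `x`, minus the
distance that remains to be covered to the right of `x`. -/
noncomputable def balance (x : ℝ) (c : Config k) : ℝ :=
  energyFrom c.pos c.energy x - totalTravelBeyond c.pos c.todo x

theorem balance_eq_sum (x : ℝ) (c : Config k) :
    balance x c =
      ∑ i, ((if x ≤ c.pos i then c.energy i else 0) - travelBeyond x (c.pos i) (c.todo i)) :=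
  (Finset.sum_sub_distrib _ _).symm

theorem balance_of_todo_eq_nil (x : ℝ) (h : ∀ i, c.todo i = []) :
    balance x c = energyFrom c.pos c.energy x := by
  simp [balance, totalTravelBeyond, travelBeyond, h, sumPieces]

theorem balance_transfer (x : ℝ) {i j : Fin k} {z : ℝ} {resti restj : Trajectory k}
    (hij : i ≠ j) (htodoi : c.todo i = Action.give j z :: resti)
    (htodoj : c.todo j = Action.receive i z :: restj) (hmeet : c.pos i = c.pos j) :
    balance x
        { pos := c.pos
          energy := Function.update (Function.update c.energy i (c.energy i - z)) j
            (c.energy j + z)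
          todo := Function.update (Function.update c.todo i resti) j restj } = balance x c := by
  set moved : ℝ := if x ≤ c.pos i then z else 0 with hmoved
  have hterm : ∀ l, ((if x ≤ c.pos l then Function.update (Function.update c.energy i
      (c.energy i - z)) j (c.energy j + z) l else 0) -
      travelBeyond x (c.pos l) (Function.update (Function.update c.todo i resti) j restj l)) =
      ((if x ≤ c.pos l then c.energy l else 0) - travelBeyond x (c.pos l) (c.todo l)) +
        ((if l = j then moved else 0) - if l = i then moved else 0) := by
    intro l
    rcases eq_or_ne l j with rfl | hlj
    · simp only [Function.update_self, htodoj, hij.symm, if_true, if_false, travelBeyond, sumPieces]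
      grind
    rcases eq_or_ne l i with rfl | hli
    · simp only [Function.update_of_ne hlj, Function.update_self, htodoi, hlj, if_true, if_false,
        travelBeyond, sumPieces]
      grind
    · simp [hlj, hli]
  simp only [balance_eq_sum, hterm, Finset.sum_add_distrib, Finset.sum_sub_distrib,
    Finset.sum_ite_eq', Finset.mem_univ, if_true, sub_self, add_zero]

theorem Step.sumPieces_le {M : Type*} [AddCommMonoid M] [Preorder M] [CanonicallyOrderedAdd M]
    (f : ℝ → ℝ → M) (h : Step c c') (i : Fin k) :
    sumPieces f (c'.pos i) (c'.todo i) ≤ sumPieces f (c.pos i) (c.todo i) := by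
  cases h with
  | move m q rest htodo =>
    rcases eq_or_ne i m with rfl | hi
    · simp [htodo, sumPieces]
    · simp [hi]
  | transfer m n x restm restn hmn htodom htodon =>
    rcases eq_or_ne i n with rfl | hi
    · simp [htodon, sumPieces]
    rcases eq_or_ne i m with rfl | hi'
    · simp [htodom, hmn, sumPieces]
    · simp [hi, hi']

theorem Step.energy_nonneg (h : Step c c') (hc : ∀ i, 0 ≤ c.energy i) (i : Fin k) :
    0 ≤ c'.energy i := by
  have hi := hc i
  cases h with
  | move m q rest _ _ henergy =>
    rcases eq_or_ne i m with rfl | him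
    · simpa using henergy
    · simpa [him] using hi
  | transfer m n x _ _ _ _ _ _ hx henergy =>
    rcases eq_or_ne i n with rfl | hin
    · simpa using add_nonneg hi hx.le
    rcases eq_or_ne i m with rfl | him
    · simpa [hin] using henergy
    · simpa [hin, him] using hi

theorem Step.pos_nonneg (h : Step c c') (hc : ∀ i, 0 ≤ c.pos i) (i : Fin k) : 0 ≤ c'.pos i := by
  cases h with
  | move m q rest _ hq =>
    rcases eq_or_ne i m with rfl | him
    · simpa using hq.1
    · simpa [him] using hc i
  | transfer => exact hc i

theorem Step.balance_le {x : ℝ} (h : Step c c')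
    (hright : ∀ i, rightCrossings x (c.pos i) (c.todo i) = 0) : balance x c' ≤ balance x c := by
  cases h with
  | move m q rest htodo _ henergy =>
    rw [balance_eq_sum, balance_eq_sum]
    refine Finset.sum_le_sum fun i _ => ?_
    rcases eq_or_ne i m with rfl | him
    · have hcross := hright i
      simp only [rightCrossings, htodo, sumPieces, Nat.add_eq_zero_iff,
        crossRight_eq_zero_iff] at hcross
      simp only [Function.update_self, htodo, travelBeyond, sumPieces]
      grind
    · simp [him]
  | transfer i j z resti restj hij htodoi htodoj hmeet =>
    exact (balance_transfer x hij htodoi htodoj hmeet).le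

theorem Step.le_balance {x : ℝ} (h : Step c c')
    (hleft : ∀ i, leftCrossings x (c.pos i) (c.todo i) = 0) : balance x c ≤ balance x c' := by
  cases h with
  | move m q rest htodo _ henergy =>
    rw [balance_eq_sum, balance_eq_sum]
    refine Finset.sum_le_sum fun i _ => ?_
    rcases eq_or_ne i m with rfl | him
    · have hcross := hleft i
      simp only [leftCrossings, htodo, sumPieces, Nat.add_eq_zero_iff,
        crossRight_eq_zero_iff] at hcross
      simp only [Function.update_self, htodo, travelBeyond, sumPieces]
      grind
    · simp [him]
  | transfer i j z resti restj hij htodoi htodoj hmeet =>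
    exact (balance_transfer x hij htodoi htodoj hmeet).ge

theorem energy_nonneg_of_run (h : Relation.ReflTransGen Step c c') (hc : ∀ i, 0 ≤ c.energy i) :
    ∀ i, 0 ≤ c'.energy i := by
  induction h with
  | refl => exact hc
  | tail _ hstep ih => exact hstep.energy_nonneg ih

theorem balance_le_of_run {x : ℝ} (h : Relation.ReflTransGen Step c c')
    (hright : ∀ i, rightCrossings x (c.pos i) (c.todo i) = 0) : balance x c' ≤ balance x c := by
  induction h using Relation.ReflTransGen.head_induction_on with
  | refl => exact le_rfl
  | head hstep _ ih =>
    refine (ih fun i => ?_).trans (hstep.balance_le hright)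
    exact Nat.le_zero.1 ((hstep.sumPieces_le _ i).trans_eq (hright i))

theorem le_balance_of_run {x : ℝ} (h : Relation.ReflTransGen Step c c')
    (hleft : ∀ i, leftCrossings x (c.pos i) (c.todo i) = 0) : balance x c ≤ balance x c' := by
  induction h using Relation.ReflTransGen.head_induction_on with
  | refl => exact le_rfl
  | head hstep _ ih =>
    refine (hstep.le_balance hleft).trans (ih fun i => ?_)
    exact Nat.le_zero.1 ((hstep.sumPieces_le _ i).trans_eq (hleft i))

theorem rightCrossings_zero_of_run (h : Relation.ReflTransGen Step c c')
    (hdone : ∀ i, c'.todo i = []) (hc : ∀ i, 0 ≤ c.pos i) (i : Fin k) :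
    rightCrossings 0 (c.pos i) (c.todo i) = 0 := by
  induction h using Relation.ReflTransGen.head_induction_on with
  | refl => simp [hdone, rightCrossings, sumPieces]
  | head hstep _ ih =>
    have hrest := ih (hstep.pos_nonneg hc)
    have hi := hc i
    unfold rightCrossings at hrest ⊢
    cases hstep with
    | move m q rest htodo =>
      rcases eq_or_ne i m with rfl | him
      · simp only [Function.update_self] at hrest
        simp [htodo, sumPieces, hrest, crossRight, hi.not_gt]
      · simpa [him] using hrest
    | transfer m n x restm restn hmn htodom htodon =>
      rcases eq_or_ne i n with rfl | hin
      · simpa [htodon, sumPieces] using hrest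
      rcases eq_or_ne i m with rfl | him
      · simpa [htodom, hmn, sumPieces] using hrest
      · simpa [hin, him] using hrest

theorem energyFrom_add_totalTravelBeyond_le {x : ℝ} (h : Relation.ReflTransGen Step c c')
    (hdone : ∀ i, c'.todo i = []) (hright : ∀ i, rightCrossings x (c.pos i) (c.todo i) = 0) :
    energyFrom c'.pos c'.energy x + totalTravelBeyond c.pos c.todo x ≤
      energyFrom c.pos c.energy x := by
  have := balance_le_of_run h hright
  rw [balance_of_todo_eq_nil x hdone] at this
  exact le_sub_iff_add_le.1 this

theorem energyFrom_le_add_totalTravelBeyond {x : ℝ} (h : Relation.ReflTransGen Step c c')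
    (hdone : ∀ i, c'.todo i = []) (hleft : ∀ i, leftCrossings x (c.pos i) (c.todo i) = 0) :
    energyFrom c.pos c.energy x ≤
      energyFrom c'.pos c'.energy x + totalTravelBeyond c.pos c.todo x := by
  have := le_balance_of_run h hleft
  rw [balance_of_todo_eq_nil x hdone] at this
  exact sub_le_iff_le_add.1 this

end Runs

/-! ### The values computed by the procedure -/

section Procedure

/-- The effect `(l, tr) ↦ (l', tr')` of one invocation of the procedure for an agent at `s` with
energy `e`, the next agent being at `s'`. An agent that goes right first never covers less to its
left than to its right (`hd`); this is all that the proof needs to know about which of the first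
two lines of case 1.2 was chosen. -/
inductive Advance (e s s' l tr : ℝ) : ℝ → ℝ → Prop
  | deficit (htr : tr ≤ 0) (he : e < s - l - tr) : Advance e s s' l tr s (e + tr - (s - l))
  | rightFirst (y : ℝ) (htr : tr ≤ 0) (h0 : 0 ≤ y) (hd : y ≤ s - l) (hg : y ≤ s' - s)
      (he : 2 * y ≤ e + tr - (s - l)) (hmax : y = s' - s ∨ 2 * y = e + tr - (s - l)) :
      Advance e s s' l tr (s + y) (e + tr - (2 * y + (s - l)))
  | leftFirst (y : ℝ) (htr : tr ≤ 0) (hd : s - l ≤ y) (hg : y ≤ s' - s)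
      (hd3 : 3 * (s - l) ≤ e + tr) (he : y ≤ e + tr - 2 * (s - l))
      (hmax : y = s' - s ∨ y = e + tr - 2 * (s - l)) :
      Advance e s s' l tr (s + y) (e + tr - (2 * (s - l) + y))
  | surplus (y : ℝ) (htr : 0 < tr) (h0 : 0 ≤ y) (hg : y ≤ s' - s) (he : y ≤ e + tr)
      (hmax : y = s' - s ∨ y = e + tr) :
      Advance e s s' l tr (s + y) (tr + e - y)

theorem Advance.le {e s s' l tr l' tr' : ℝ} (h : Advance e s s' l tr l' tr') (hl : l ≤ s) :
    s ≤ l' := by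
  cases h <;> linarith

theorem Advance.le_next {e s s' l tr l' tr' : ℝ} (h : Advance e s s' l tr l' tr') (hs : s ≤ s') :
    l' ≤ s' := by
  cases h <;> linarith

theorem Advance.eq_next_of_pos {e s s' l tr l' tr' : ℝ} (h : Advance e s s' l tr l' tr')
    (htr' : 0 < tr') : l' = s' := by
  cases h with
  | deficit htr he => linarith
  | rightFirst y htr h0 hd hg he hmax => rcases hmax with h | h <;> linarith
  | leftFirst y htr hd hg hd3 he hmax => rcases hmax with h | h <;> linarith
  | surplus y htr h0 hg he hmax => rcases hmax with h | h <;> linarith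

variable {k : ℕ} {s e : Fin k → ℝ}

/-- The position of agent number `j`, counted from `0`; all the agents from number `k` on are dummy
agents at `1`. -/
noncomputable def station (s : Fin k → ℝ) (j : ℕ) : ℝ := if h : j < k then s ⟨j, h⟩ else 1

@[simp]
theorem station_coe (s : Fin k → ℝ) (i : Fin k) : station s i = s i := dif_pos i.2

theorem station_of_le (s : Fin k → ℝ) {j : ℕ} (h : k ≤ j) : station s j = 1 :=
  dif_neg h.not_gt

theorem station_mem (hs : ∀ i, s i ∈ Set.Icc (0 : ℝ) 1) (j : ℕ) :
    station s j ∈ Set.Icc (0 : ℝ) 1 := by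
  unfold station
  split_ifs
  · exact hs _
  · exact ⟨zero_le_one, le_rfl⟩

theorem station_mono (hmono : Monotone s) (hs : ∀ i, s i ≤ 1) : Monotone (station s) := by
  intro a b hab
  unfold station
  split_ifs with ha hb hb
  · exact hmono hab
  · exact hs _
  · omega
  · exact le_rfl

/-- The values `l`, `tr` are those obtained by the invocations for the first `j` agents. -/
inductive Reach (s e : Fin k → ℝ) : ℕ → ℝ → ℝ → Prop
  | zero : Reach s e 0 0 0
  | succ {i : Fin k} {l tr l' tr' : ℝ} (h : Reach s e i l tr)
      (hadv : Advance (e i) (s i) (station s (i + 1)) l tr l' tr') : Reach s e (i + 1) l' tr'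

theorem le_station_succ (hmono : Monotone s) (hs : ∀ i, s i ≤ 1) (i : Fin k) :
    s i ≤ station s (i + 1) :=
  (station_coe s i).ge.trans (station_mono hmono hs (Nat.le_succ _))

theorem Reach.le_station (hmono : Monotone s) (hs : ∀ i, s i ∈ Set.Icc (0 : ℝ) 1) {j : ℕ}
    {l tr : ℝ} (h : Reach s e j l tr) : l ≤ station s j := by
  cases h with
  | zero => exact (station_mem hs 0).1
  | succ _ hadv => exact hadv.le_next (le_station_succ hmono (fun i => (hs i).2) _)

theorem Reach.eq_station_of_pos {j : ℕ} {l tr : ℝ} (h : Reach s e j l tr) (htr : 0 < tr) :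
    l = station s j := by
  cases h with
  | zero => exact absurd htr (lt_irrefl _)
  | succ _ hadv => exact hadv.eq_next_of_pos htr

theorem Reach.le_of_lt (hmono : Monotone s) (hs : ∀ i, s i ∈ Set.Icc (0 : ℝ) 1) {j : ℕ}
    {l tr : ℝ} (h : Reach s e j l tr) (i : Fin k) (hi : i < j) : s i ≤ l := by
  cases h with
  | zero => omega
  | succ h hadv =>
    have := h.le_station hmono hs
    rw [station_coe] at this
    exact (hmono (Nat.lt_succ_iff.1 hi)).trans (hadv.le this)

theorem Reach.nonneg (hmono : Monotone s) (hs : ∀ i, s i ∈ Set.Icc (0 : ℝ) 1) {j : ℕ}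
    {l tr : ℝ} (h : Reach s e j l tr) : 0 ≤ l := by
  cases h with
  | zero => exact le_rfl
  | succ h hadv => exact (hs _).1.trans ((h.succ hadv).le_of_lt hmono hs _ (Nat.lt_succ_self _))

end Procedure

/-! ### Necessity -/

section Necessity

variable {k : ℕ} {s e : Fin k → ℝ} {T : Fin k → Trajectory k} {c' : Config k}

/-- The total energy of the agents from number `j` on, counted from `0`. -/
noncomputable def tailEnergy (e : Fin k → ℝ) (j : ℕ) : ℝ := ∑ i : Fin k, if j ≤ i then e i else 0

theorem tailEnergy_coe (e : Fin k → ℝ) (i : Fin k) :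
    tailEnergy e i = e i + tailEnergy e (i + 1) := by
  have hterm (m : Fin k) : (if (i : ℕ) ≤ m then e m else 0) =
      (if m = i then e i else 0) + if (i : ℕ) + 1 ≤ m then e m else 0 := by
    grind
  simp only [tailEnergy, hterm, Finset.sum_add_distrib, Finset.sum_ite_eq', Finset.mem_univ,
    if_true]

theorem tailEnergy_self (e : Fin k → ℝ) : tailEnergy e k = 0 :=
  Finset.sum_eq_zero fun i _ => if_neg i.2.not_ge

theorem energyFrom_eq_tailEnergy {j : ℕ} {x : ℝ} (hlt : ∀ i : Fin k, i < j → s i < x)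
    (hle : ∀ i : Fin k, j ≤ i → x ≤ s i) : energyFrom s e x = tailEnergy e j :=
  Finset.sum_congr rfl fun i _ =>
    if_congr ⟨fun h => not_lt.1 fun hi => (hlt i hi).not_ge h, hle i⟩ rfl rfl

/-- In a run that follows the trajectories `T` from the positions `s` and ends in `c'`, the distance
covered beyond `l` and the energy left beyond `l` sum up to at most `b`. -/
def UsedBeyondLE (s : Fin k → ℝ) (T : Fin k → Trajectory k) (c' : Config k) (l b : ℝ) : Prop :=
  ∀ x, l < x → totalTravelBeyond s T l + energyFrom c'.pos c'.energy x ≤ b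

theorem UsedBeyondLE.of_le (hexp : Explores s T) {u v b b' : ℝ} (h : UsedBeyondLE s T c' u b)
    (hu : 0 ≤ u) (huv : u ≤ v) (hv : v ≤ 1) (hb : b - (v - u) ≤ b') :
    UsedBeyondLE s T c' v b' := fun x hx => by
  linarith [h x (huv.trans_lt hx), hexp.sub_le_totalTravelBeyond hu huv hv]

/-- The energy beyond `z` does not suffice, so some agent has to carry energy back to the left. -/
theorem UsedBeyondLE.exists_leftCrossings_ne_zero
    (hrun : Relation.ReflTransGen Step ⟨s, e, T⟩ c') (hdone : ∀ i, c'.todo i = [])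
    (hexp : Explores s T) {j : ℕ} {l tr z : ℝ} (h : UsedBeyondLE s T c' l (tr + tailEnergy e j))
    (htr : tr ≤ 0) (hl : 0 ≤ l) (hlz : l < z) (hz : z ≤ 1) (hlt : ∀ i : Fin k, i < j → s i < z)
    (hle : ∀ i : Fin k, j ≤ i → z ≤ s i) : ∃ i, leftCrossings z (s i) (T i) ≠ 0 := by
  by_contra! hleft
  have henergy := energyFrom_le_add_totalTravelBeyond hrun hdone hleft
  dsimp only at henergy
  rw [energyFrom_eq_tailEnergy hlt hle] at henergy
  linarith [h z hlz, hexp.sub_le_totalTravelBeyond hl hlz.le hz]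

/-- Agent `i` has to explore `[l, s i + y]`, and a stretch of length `w` on one of its two sides has
to be covered twice, since otherwise no energy passes from the left of `s i` to its right. -/
theorem UsedBeyondLE.of_balanced
    (hrun : Relation.ReflTransGen Step ⟨s, e, T⟩ c') (hdone : ∀ i, c'.todo i = [])
    (hexp : Explores s T) (he : ∀ i, 0 ≤ e i) {i : Fin k} {l tr y w : ℝ}
    (h : UsedBeyondLE s T c' l (tr + tailEnergy e i)) (htr : tr ≤ 0) (hl : 0 ≤ l)
    (hprev : ∀ m < i, s m ≤ l) (hls : l ≤ s i) (hw : 0 ≤ w) (hwy : w ≤ y) (hwd : w ≤ s i - l)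
    (hmono : Monotone s) (hnext : ∀ m, i < m → s i + y ≤ s m) (hy1 : s i + y ≤ 1)
    (hw2 : 2 * w ≤ e i + tr - (s i - l)) :
    UsedBeyondLE s T c' (s i + y)
      (e i + tr - (s i - l) - y - w + tailEnergy e (i + 1)) := by
  intro x hx
  rw [tailEnergy_coe] at h
  have hused := h x (by linarith)
  have hleft := hexp.sub_le_totalTravelBeyond hl hls (by linarith)
  have hright : y ≤ totalTravelBeyond s T (s i) - totalTravelBeyond s T (s i + y) := by
    simpa using hexp.sub_le_totalTravelBeyond (by linarith) (by linarith : s i ≤ s i + y) hy1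
  by_cases htwice_left : ∀ z ∈ Set.Ioo l (s i), 2 ≤ totalCrossings s T z
  · have := mul_sub_le_totalTravelBeyond hls htwice_left
    push_cast at this
    linarith
  by_cases htwice_right : ∀ z ∈ Set.Ioo (s i) (s i + w), 2 ≤ totalCrossings s T z
  · have := mul_sub_le_totalTravelBeyond (by linarith) htwice_right
    have := hexp.sub_le_totalTravelBeyond (by linarith) (by linarith : s i + w ≤ s i + y) hy1
    push_cast at *
    linarith
  push Not at htwice_left htwice_right
  obtain ⟨z, ⟨hlz, hzs⟩, hz⟩ := htwice_left
  obtain ⟨z', ⟨hsz', hzw'⟩, hz'⟩ := htwice_right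
  rw [← tailEnergy_coe] at h
  have hcarry := h.exists_leftCrossings_ne_zero hrun hdone hexp htr hl hlz (by linarith)
    (fun m hm => (hprev m hm).trans_lt hlz) fun m hm => hzs.le.trans (hmono hm)
  have hnone := rightCrossings_eq_zero_of_totalCrossings_le_one (hzs.trans hsz')
    (fun m hm => (hprev m hm).trans_lt hlz) (fun m hm => by linarith [hnext m hm])
    (Nat.lt_succ_iff.1 hz) (Nat.lt_succ_iff.1 hz') hcarry
  have henergy := energyFrom_add_totalTravelBeyond_le hrun hdone hnone
  dsimp only at henergy
  rw [energyFrom_eq_tailEnergy (j := i + 1)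
    (fun m hm => (hmono (Nat.lt_succ_iff.1 hm)).trans_lt hsz')
    (fun m hm => by linarith [hnext m hm])] at henergy
  have hleftover : energyFrom c'.pos c'.energy x ≤ energyFrom c'.pos c'.energy z' :=
    energyFrom_anti (energy_nonneg_of_run hrun he) (by linarith)
  linarith [hexp.sub_le_totalTravelBeyond (by linarith) (by linarith : z' ≤ s i + y) hy1]

theorem Reach.usedBeyondLE (hmono : Monotone s) (hs : ∀ i, s i ∈ Set.Icc (0 : ℝ) 1)
    (he : ∀ i, 0 ≤ e i) (hrun : Relation.ReflTransGen Step ⟨s, e, T⟩ c')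
    (hdone : ∀ i, c'.todo i = []) (hexp : Explores s T) {j : ℕ} {l tr : ℝ}
    (h : Reach s e j l tr) : UsedBeyondLE s T c' l (tr + tailEnergy e j) := by
  induction h with
  | zero =>
    intro x hx
    have henergy := energyFrom_add_totalTravelBeyond_le hrun hdone
      (rightCrossings_zero_of_run hrun hdone fun i => (hs i).1)
    dsimp only at henergy
    rw [energyFrom_eq_tailEnergy (j := 0) (by simp) fun i _ => (hs i).1] at henergy
    linarith [energyFrom_anti (pos := c'.pos) (energy_nonneg_of_run hrun he) hx.le]
  | @succ i l tr l' tr' h hadv ih =>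
    have hl := h.nonneg hmono hs
    have hls := h.le_station hmono hs
    rw [station_coe] at hls
    have hstation := (station_mem hs (i + 1)).2
    have hnext {y : ℝ} (hy : y ≤ station s (i + 1) - s i) (m : Fin k) (hm : i < m) :
        s i + y ≤ s m := by
      have := station_mono hmono (fun i => (hs i).2) (Nat.succ_le_of_lt hm)
      rw [station_coe] at this
      linarith
    have hbalanced {y w : ℝ} := UsedBeyondLE.of_balanced (y := y) (w := w) hrun hdone hexp he ih
    cases hadv with
    | deficit htr he =>
      rw [tailEnergy_coe] at ih
      exact ih.of_le hexp hl hls (hs i).2 (by linarith)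
    | rightFirst y htr h0 hd hg he hmax =>
      have := hbalanced (y := y) (w := y) htr hl (h.le_of_lt hmono hs) hls h0 le_rfl hd hmono
        (hnext hg) (by linarith) he
      rwa [show e i + tr - (2 * y + (s i - l)) = e i + tr - (s i - l) - y - y by ring]
    | leftFirst y htr hd hg hd3 he hmax =>
      have := hbalanced (y := y) (w := s i - l) htr hl (h.le_of_lt hmono hs) hls (by linarith) hd
        le_rfl hmono (hnext hg) (by linarith) (by linarith)
      rwa [show e i + tr - (2 * (s i - l) + y) = e i + tr - (s i - l) - y - (s i - l) by ring]
    | surplus y htr h0 hg he hmax =>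
      have := h.eq_station_of_pos htr
      rw [station_coe] at this
      rw [tailEnergy_coe] at ih
      exact ih.of_le hexp hl (by linarith) (by linarith) (by linarith)

theorem Reach.one_le_and_nonneg_of_explores (hmono : Monotone s)
    (hs : ∀ i, s i ∈ Set.Icc (0 : ℝ) 1) (he : ∀ i, 0 ≤ e i) {l tr : ℝ} (h : Reach s e k l tr)
    (hvalid : Valid s e T) (hexp : Explores s T) : 1 ≤ l ∧ 0 ≤ tr := by
  obtain ⟨c', hrun, hdone⟩ := hvalid
  have hl := h.le_station hmono hs
  have hfull := h.eq_station_of_pos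
  rw [station_of_le s le_rfl] at hl hfull
  have hused := h.usedBeyondLE hmono hs he hrun hdone hexp (l + 1) (lt_add_one l)
  rw [tailEnergy_self, add_zero] at hused
  have hleftover := energyFrom_nonneg (pos := c'.pos) (energy_nonneg_of_run hrun he) (l + 1)
  have htravel := hexp.sub_le_totalTravelBeyond (h.nonneg hmono hs) hl le_rfl
  have htravel_nonneg := totalTravelBeyond_nonneg s T 1
  refine ⟨?_, by linarith⟩
  by_contra! hl1
  linarith [hfull (by linarith)]

end Necessity

/-! ### Sufficiency -/

section Sufficiency

variable {k : ℕ}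

/-- Agents at the positions `pos` with the energies `en` have valid trajectories that together visit
every point of `U`. -/
def CanExplore (pos en : Fin k → ℝ) (U : Set ℝ) : Prop :=
  ∃ T, Valid pos en T ∧ U ⊆ ⋃ i, visited (pos i) (T i)

/-- The agents can pass from positions `pos` and energies `en` to `pos'` and `en'` while visiting
`V`. The passage is described by what it contributes to a later exploration, so that passages
compose without any concatenation of trajectories. -/
def Run (pos en pos' en' : Fin k → ℝ) (V : Set ℝ) : Prop :=
  ∀ U, CanExplore pos' en' U → CanExplore pos en (V ∪ U)

variable {pos en pos' en' pos'' en'' : Fin k → ℝ} {V V' : Set ℝ}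

theorem CanExplore.empty (pos en : Fin k → ℝ) : CanExplore pos en ∅ :=
  ⟨fun _ => [], ⟨_, .refl, fun _ => rfl⟩, Set.empty_subset _⟩

theorem Run.canExplore (h : Run pos en pos' en' V) : CanExplore pos en V := by
  simpa only [Set.union_empty] using h ∅ (.empty _ _)

theorem Run.refl (pos en : Fin k → ℝ) : Run pos en pos en ∅ := fun U h => by
  rwa [Set.empty_union]

theorem Run.trans (h : Run pos en pos' en' V) (h' : Run pos' en' pos'' en'' V') :
    Run pos en pos'' en'' (V ∪ V') := fun U hU => by
  rw [Set.union_assoc]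
  exact h _ (h' U hU)

theorem Run.mono (h : Run pos en pos' en' V) (hV : V' ⊆ V) : Run pos en pos' en' V' := fun U hU =>
  let ⟨T, hvalid, hsub⟩ := h U hU
  ⟨T, hvalid, (Set.union_subset_union_left U hV).trans hsub⟩

theorem Run.move (pos en : Fin k → ℝ) (i : Fin k) {q : ℝ} (hq : q ∈ Set.Icc (0 : ℝ) 1)
    (henergy : |q - pos i| ≤ en i) :
    Run pos en (Function.update pos i q) (Function.update en i (en i - |q - pos i|))
      (Set.uIcc (pos i) q) := by
  rintro U ⟨T, ⟨c, hrun, hdone⟩, hU⟩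
  refine ⟨Function.update T i (.move q :: T i), ⟨c, .head ?_ hrun, hdone⟩, ?_⟩
  · simpa using Step.move ⟨pos, en, Function.update T i (.move q :: T i)⟩ i q (T i)
      (Function.update_self ..) hq henergy
  · have hi : Set.uIcc (pos i) q ∪ visited q (T i) ⊆
        ⋃ r, visited (pos r) (Function.update T i (.move q :: T i) r) := by
      refine (Eq.subset ?_).trans (Set.subset_iUnion _ i)
      rw [Function.update_self, visited]
    refine Set.union_subset (Set.subset_union_left.trans hi)
      (hU.trans (Set.iUnion_subset fun r => ?_))
    obtain rfl | hr := eq_or_ne r i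
    · rw [Function.update_self]
      exact Set.subset_union_right.trans hi
    · refine (Eq.subset ?_).trans (Set.subset_iUnion _ r)
      rw [Function.update_of_ne hr, Function.update_of_ne hr]

theorem Run.transfer (en : Fin k → ℝ) {i j : Fin k} (hij : i ≠ j) (hmeet : pos i = pos j) {x : ℝ}
    (hx : 0 < x) (henergy : x ≤ en i) :
    Run pos en pos (Function.update (Function.update en i (en i - x)) j (en j + x)) ∅ := by
  rintro U ⟨T, ⟨c, hrun, hdone⟩, hU⟩
  refine ⟨Function.update (Function.update T i (.give j x :: T i)) j (.receive i x :: T j),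
    ⟨c, .head ?_ hrun, hdone⟩, ?_⟩
  · simpa [Function.update_comm hij] using Step.transfer
      ⟨pos, en, Function.update (Function.update T i (.give j x :: T i)) j (.receive i x :: T j)⟩
      i j x (T i) (T j) hij (by simp [hij]) (by simp) hmeet hx henergy
  · rw [Set.empty_union]
    refine hU.trans (Set.iUnion_mono fun r => Eq.subset ?_)
    obtain rfl | hj := eq_or_ne r j
    · rw [Function.update_self, visited]
    obtain rfl | hi := eq_or_ne r i
    · rw [Function.update_of_ne hj, Function.update_self, visited]
    · rw [Function.update_of_ne hj, Function.update_of_ne hi]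

theorem Run.exchange {i j : Fin k} (hij : i ≠ j) (hmeet : pos i = pos j) {t : ℝ} (hi : t ≤ en i)
    (hj : 0 ≤ en j + t) :
    Run pos en pos (Function.update (Function.update en i (en i - t)) j (en j + t)) ∅ := by
  obtain ht | rfl | ht := lt_trichotomy t 0
  · have := Run.transfer en hij.symm hmeet.symm (neg_pos.2 ht) (by linarith)
    rwa [sub_neg_eq_add, ← sub_eq_add_neg, Function.update_comm hij.symm] at this
  · simpa using Run.refl pos en
  · exact .transfer en hij hmeet ht hi

theorem Run.exists_move (pos en : Fin k → ℝ) (i : Fin k) {q : ℝ} (hq : q ∈ Set.Icc (0 : ℝ) 1)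
    (henergy : |q - pos i| ≤ en i) :
    ∃ pos' en', Run pos en pos' en' (Set.uIcc (pos i) q) ∧ pos' i = q ∧
      en' i = en i - |q - pos i| ∧ ∀ r ≠ i, pos' r = pos r ∧ en' r = en r :=
  ⟨_, _, .move pos en i hq henergy, by simp, by simp, fun r hr => by simp [hr]⟩

theorem Run.exists_exchange_next {i : Fin k} {t : ℝ} (hi : t ≤ en i)
    (hlast : (i : ℕ) + 1 = k → 0 ≤ t)
    (hnext : ∀ r : Fin k, (r : ℕ) = i + 1 → pos r = pos i ∧ 0 ≤ en r + t) :
    ∃ en', Run pos en pos en' ∅ ∧ en i - t ≤ en' i ∧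
      (∀ r : Fin k, (r : ℕ) = i + 1 → en' r = en r + t) ∧
      ∀ r : Fin k, r ≠ i → (r : ℕ) ≠ i + 1 → en' r = en r := by
  obtain hk | hk := (Nat.succ_le_of_lt i.2).eq_or_lt
  · exact ⟨en, .refl _ _, sub_le_self _ (hlast hk), fun r hr => absurd r.2 (by omega),
      fun _ _ _ => rfl⟩
  · have hne : i ≠ ⟨i + 1, hk⟩ := fun h => by simpa using congrArg Fin.val h
    obtain ⟨hmeet, hr⟩ := hnext ⟨i + 1, hk⟩ rfl
    refine ⟨_, .exchange hne hmeet.symm hi hr, ?_, fun r hr => ?_, fun r hri hr => ?_⟩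
    · rw [Function.update_of_ne hne, Function.update_self]
    · obtain rfl : r = ⟨i + 1, hk⟩ := Fin.ext hr
      rw [Function.update_self]
    · rw [Function.update_of_ne fun h => hr (congrArg Fin.val h), Function.update_of_ne hri]

variable {s e : Fin k → ℝ} {l tr : ℝ}

/-- From their initial positions and with their initial energies, the first `j` agents can visit
`[0,l)` and hand the amount `t` (or take `-t`, if `t < 0`) to agent number `j`, counted from `0`,
that waits at `l`. If there is no such agent, then there is nobody to take energy from, and the
amount `t ≥ 0` is just left over. -/
def CanServe (s e : Fin k → ℝ) (j : ℕ) (l t : ℝ) : Prop :=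
  ∀ pos en : Fin k → ℝ, (∀ i : Fin k, i < j → pos i = s i ∧ en i = e i) → (j = k → 0 ≤ t) →
    (∀ i : Fin k, (i : ℕ) = j → pos i = l ∧ 0 ≤ en i + t) →
    ∃ pos' en', Run pos en pos' en' (Set.Ico 0 l) ∧ (∀ i : Fin k, j ≤ i → pos' i = pos i) ∧
      (∀ i : Fin k, j < i → en' i = en i) ∧ ∀ i : Fin k, (i : ℕ) = j → en' i = en i + t

theorem CanServe.zero (s e : Fin k → ℝ) : CanServe s e 0 0 0 := fun pos en _ _ _ =>
  ⟨pos, en, (Run.refl pos en).mono (Set.Ico_self 0).subset, fun _ _ => rfl, fun _ _ => rfl,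
    fun _ _ => (add_zero _).symm⟩

theorem Ico_subset_uIcc_union_Ico (a b c : ℝ) : Set.Ico a c ⊆ Set.uIcc b c ∪ Set.Ico a b :=
  fun z hz => (lt_or_ge z b).elim (fun h => .inr ⟨hz.1, h⟩)
    fun h => .inl (Set.Icc_subset_uIcc ⟨h, hz.2.le⟩)

/-- Agent `i` settles the balance `t` with the next agent before it turns back to serve the previous
ones. For `y = 0` and `t < 0` it waits at home until the next agent brings the missing energy. -/
theorem CanServe.rightFirst {i : Fin k} (h : CanServe s e i l tr) (hl : l ∈ Set.Icc (0 : ℝ) 1)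
    (hls : l ≤ s i) (htr : tr ≤ 0) {y t : ℝ} (hy : 0 ≤ y) (hye : y ≤ e i) (hy1 : s i + y ≤ 1)
    (ht : t = e i + tr - (2 * y + (s i - l))) : CanServe s e (i + 1) (s i + y) t := by
  intro pos en hhome hlast hnext
  obtain ⟨hpos, hen⟩ := hhome i (Nat.lt_succ_self i)
  have hright : |s i + y - pos i| = y := by rw [hpos, add_sub_cancel_left, abs_of_nonneg hy]
  obtain ⟨pos₁, en₁, run₁, hpos₁, hen₁, hrest₁⟩ := Run.exists_move pos en i
    (q := s i + y) ⟨by linarith [hl.1], hy1⟩ (by rwa [hright, hen])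
  obtain ⟨en₂, run₂, hen₂, hnext₂, hrest₂⟩ := Run.exists_exchange_next (pos := pos₁) (en := en₁)
    (i := i) (t := t) (by linarith) hlast (by grind)
  have hleft : |l - pos₁ i| = s i + y - l := by
    rw [hpos₁, abs_sub_comm, abs_of_nonneg (by linarith)]
  obtain ⟨pos₃, en₃, run₃, hpos₃, hen₃, hrest₃⟩ := Run.exists_move pos₁ en₂ i hl (by linarith)
  obtain ⟨pos₄, en₄, run₄, hpos₄, hen₄, -⟩ := h pos₃ en₃ (by grind) (by grind) fun r hr => by
    obtain rfl := Fin.ext hr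
    exact ⟨hpos₃, by linarith⟩
  refine ⟨pos₄, en₄, (((run₁.trans run₂).trans run₃).trans run₄).mono ?_, ?_, ?_, ?_⟩
  · rw [hpos₁, Set.uIcc_comm (s i + y) l]
    exact (Ico_subset_uIcc_union_Ico 0 l (s i + y)).trans
      (Set.union_subset_union_left _ Set.subset_union_right)
  · grind
  · grind
  · grind

theorem CanServe.leftFirst {i : Fin k} (h : CanServe s e i l tr) (hl : l ∈ Set.Icc (0 : ℝ) 1)
    (hls : l ≤ s i) (hd : s i - l ≤ e i) (hd' : s i - l ≤ e i + tr) {y t : ℝ}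
    (hy : 0 ≤ y) (hye : y ≤ e i + tr - 2 * (s i - l)) (hy1 : s i + y ≤ 1)
    (ht : t = e i + tr - (2 * (s i - l) + y)) : CanServe s e (i + 1) (s i + y) t := by
  intro pos en hhome hlast hnext
  obtain ⟨hpos, hen⟩ := hhome i (Nat.lt_succ_self i)
  have hleft : |l - pos i| = s i - l := by rw [hpos, abs_sub_comm, abs_of_nonneg (by linarith)]
  obtain ⟨pos₁, en₁, run₁, hpos₁, hen₁, hrest₁⟩ := Run.exists_move pos en i hl (by linarith)
  obtain ⟨pos₂, en₂, run₂, hpos₂, hen₂, hserved⟩ := h pos₁ en₁ (by grind) (by grind) fun r hr => by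
    obtain rfl := Fin.ext hr
    exact ⟨hpos₁, by linarith⟩
  have hposi := hpos₂ i le_rfl
  have heni := hserved i rfl
  have hright : |s i + y - pos₂ i| = s i + y - l := by
    rw [hposi, hpos₁, abs_of_nonneg (by linarith)]
  obtain ⟨pos₃, en₃, run₃, hpos₃, hen₃, hrest₃⟩ := Run.exists_move pos₂ en₂ i
    (q := s i + y) ⟨by linarith [hl.1], hy1⟩ (by linarith)
  obtain ⟨en₄, run₄, -, hnext₄, hrest₄⟩ := Run.exists_exchange_next (pos := pos₃) (en := en₃)
    (i := i) (t := t) (by linarith) hlast (by grind)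
  refine ⟨pos₃, en₄, (((run₁.trans run₂).trans run₃).trans run₄).mono ?_, ?_, ?_, ?_⟩
  · rw [hposi, hpos₁]
    grind [Ico_subset_uIcc_union_Ico 0 l (s i + y)]
  · grind
  · grind
  · grind

theorem Reach.canServe (hmono : Monotone s) (hs : ∀ i, s i ∈ Set.Icc (0 : ℝ) 1)
    (he : ∀ i, 0 ≤ e i) {j : ℕ} (h : Reach s e j l tr) : CanServe s e j l tr := by
  induction h with
  | zero => exact .zero s e
  | @succ i l tr _ _ h hadv ih =>
    have hls := h.le_station hmono hs
    have heq := h.eq_station_of_pos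
    rw [station_coe] at hls heq
    have hl : l ∈ Set.Icc (0 : ℝ) 1 := ⟨h.nonneg hmono hs, hls.trans (hs i).2⟩
    have hei := he i
    have hnext := (station_mem hs (i + 1)).2
    cases hadv with
    | deficit htr hlt =>
      simpa using ih.rightFirst hl hls htr le_rfl hei (by simpa using (hs i).2) rfl
    | rightFirst y htr h0 hd hg hy hmax =>
      exact ih.rightFirst hl hls htr h0 (by linarith) (by linarith) rfl
    | leftFirst y htr hd hg hd3 hy hmax =>
      exact ih.leftFirst hl hls (by linarith) (by linarith) (by linarith) hy (by linarith) rfl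
    | surplus y htr h0 hg hy hmax =>
      have := heq htr
      exact ih.leftFirst hl hls (by linarith) (by linarith) h0 (by linarith) (by linarith)
        (by linarith)

theorem Reach.exists_explores (hmono : Monotone s) (hs : ∀ i, s i ∈ Set.Icc (0 : ℝ) 1)
    (he : ∀ i, 0 ≤ e i) (h : Reach s e k l tr) (hl : 1 ≤ l) (htr : 0 ≤ tr) :
    ∃ T, Valid s e T ∧ Explores s T := by
  obtain ⟨pos', en', hrun, -⟩ := h.canServe hmono hs he s e (fun _ _ => ⟨rfl, rfl⟩) (fun _ => htr)
    fun i hi => absurd hi i.2.ne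
  obtain ⟨T, hvalid, hsub⟩ := hrun.canExplore
  have hclosed : IsClosed (⋃ i, visited (s i) (T i)) :=
    isClosed_iUnion_of_finite fun i => isClosed_visited _ _
  refine ⟨T, hvalid, ?_⟩
  rw [Explores, ← closure_Ico zero_ne_one]
  exact hclosed.closure_subset_iff.2 ((Set.Ico_subset_Ico_right hl).trans hsub)

end Sufficiency

/-! ### Execution of the procedure -/

section Execution

theorem Cmd.exists_time_le (c : Cmd) :
    ∃ C : ℕ, ∀ (k : ℕ) (I : Input k) (i : ℕ) (σ : Var → ℝ), (c.exec I i σ).2 ≤ C := by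
  induction c with
  | assign v a => exact ⟨_, fun k I i σ => le_rfl⟩
  | seq c₁ c₂ ih₁ ih₂ =>
    obtain ⟨C₁, h₁⟩ := ih₁
    obtain ⟨C₂, h₂⟩ := ih₂
    refine ⟨C₁ + C₂, fun k I i σ => ?_⟩
    have h := h₁ k I i σ
    rw [Cmd.exec]
    rcases hc : c₁.exec I i σ with ⟨o, t⟩
    rw [hc] at h
    cases o with
    | next σ' => exact add_le_add h (h₂ k I i σ')
    | call a b => exact h.trans (Nat.le_add_right _ _)
    | ret r => exact h.trans (Nat.le_add_right _ _)
  | ite p c₁ c₂ ih₁ ih₂ =>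
    obtain ⟨C₁, h₁⟩ := ih₁
    obtain ⟨C₂, h₂⟩ := ih₂
    refine ⟨p.time + 1 + (C₁ + C₂), fun k I i σ => ?_⟩
    have h := h₁ k I i σ
    have h' := h₂ k I i σ
    rw [Cmd.exec]
    split_ifs <;> dsimp only <;> omega
  | call a b => exact ⟨_, fun k I i σ => le_rfl⟩
  | ret r => exact ⟨_, fun k I i σ => le_rfl⟩

variable {k : ℕ}

theorem Cmd.exec_seq_of_next {I : Input k} {i : ℕ} {c₁ c₂ : Cmd} {σ σ' : Var → ℝ}
    (h : (c₁.exec I i σ).1 = .next σ') :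
    ((Cmd.seq c₁ c₂).exec I i σ).1 = (c₂.exec I i σ').1 := by
  rcases hc : c₁.exec I i σ with ⟨o, t⟩
  rw [hc] at h
  obtain rfl : o = .next σ' := h
  rw [Cmd.exec, hc]

/-- The command `c`, executed for an agent `i` with the arguments `l` and `tr`, falls through and
leaves values of `ℓ_{i+1}` and `tr_{i+1}` that are related to `l` and `tr` by `Advance`. -/
def Cmd.Advances (c : Cmd) (I : Input k) (i : ℕ) (l tr : ℝ) : Prop :=
  ∃ σ, (c.exec I i (initStore l tr)).1 = .next σ ∧
    Advance (entry I.energy i) (entry I.pos i) (entry I.pos (i + 1)) l tr (σ .nextL) (σ .nextTr)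

variable {I : Input k} {i : ℕ} {l tr : ℝ}

theorem Cmd.Advances.ite {p : Test} {c₁ c₂ : Cmd}
    (h₁ : p.Holds I i (initStore l tr) → c₁.Advances I i l tr)
    (h₂ : ¬p.Holds I i (initStore l tr) → c₂.Advances I i l tr) :
    (Cmd.ite p c₁ c₂).Advances I i l tr := by
  unfold Cmd.Advances
  rw [Cmd.exec]
  split_ifs with hp
  · exact h₁ hp
  · exact h₂ hp

theorem advances_deficitCase (htr : tr ≤ 0)
    (he : entry I.energy i < entry I.pos i - l - tr) : deficitCase.Advances I i l tr :=
  ⟨_, rfl, by simpa [RealExpr.eval, initStore] using Advance.deficit htr he⟩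

theorem advances_surplusCase (hpos : entry I.pos i ≤ entry I.pos (i + 1))
    (hen : 0 ≤ entry I.energy i) (htr : 0 < tr) : surplusCase.Advances I i l tr := by
  refine ⟨_, rfl, ?_⟩
  simpa [RealExpr.eval, initStore] using Advance.surplus (l := l) _ htr
    (le_min (sub_nonneg.2 hpos) (add_nonneg hen htr.le)) (min_le_left _ _) (min_le_right _ _)
    (min_choice _ _)

theorem advances_balancedCase (hpos : entry I.pos i ≤ entry I.pos (i + 1)) (htr : tr ≤ 0)
    (he : entry I.pos i - l - tr ≤ entry I.energy i) : balancedCase.Advances I i l tr := by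
  by_cases h3 : entry I.energy i + tr ≤ 3 * (entry I.pos i - l)
  · have hhalf := min_le_left ((entry I.energy i + tr - (entry I.pos i - l)) / 2)
      (entry I.pos (i + 1) - entry I.pos i)
    refine ⟨_, by simp [balancedCase, Cmd.exec, Test.Holds, RealExpr.eval, initStore, h3]; rfl, ?_⟩
    simpa [h3] using Advance.rightFirst _ htr (le_min (by linarith) (by linarith)) (by linarith)
      (min_le_right _ _) (by linarith) ((min_choice _ _).symm.imp_right fun h => by rw [h]; ring)
  by_cases hg : entry I.pos (i + 1) - entry I.pos i ≤ entry I.pos i - l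
  · refine ⟨_, by
      simp [balancedCase, Cmd.exec, Test.Holds, RealExpr.eval, initStore, h3, hg]
      rfl, ?_⟩
    simpa using Advance.rightFirst _ htr (sub_nonneg.2 hpos) hg le_rfl (by linarith) (.inl rfl)
  · refine ⟨_, by
      simp [balancedCase, Cmd.exec, Test.Holds, RealExpr.eval, initStore, h3, hg]
      rfl, ?_⟩
    simpa using Advance.leftFirst _ htr (le_min (by linarith) (by linarith)) (min_le_right _ _)
      (by linarith) (min_le_left _ _) (min_choice _ _).symm

open Classical in
theorem exists_exec_pathBody (hpos : entry I.pos i ≤ entry I.pos (i + 1))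
    (hen : 0 ≤ entry I.energy i) :
    ∃ l' tr', Advance (entry I.energy i) (entry I.pos i) (entry I.pos (i + 1)) l tr l' tr' ∧
      (pathBody.exec I i (initStore l tr)).1 =
        if i < k then .call l' tr' else .ret (decide (1 ≤ l' ∧ 0 ≤ tr')) := by
  have hcases : (Cmd.ite (.le (.var .tr) (.const 0)) (.ite (.lt .energy (.sub (.sub .pos (.var .l))
      (.var .tr))) deficitCase balancedCase) surplusCase).Advances I i l tr := by
    refine .ite (fun htr => .ite (fun he => ?_) fun he => ?_) fun htr => ?_ <;>
      simp only [Test.Holds, RealExpr.eval, initStore, Nat.cast_zero, not_le, not_lt] at *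
    · exact advances_deficitCase htr he
    · exact advances_balancedCase hpos htr he
    · exact advances_surplusCase hpos hen htr
  obtain ⟨σ, hnext, hadv⟩ := hcases
  refine ⟨_, _, hadv, ?_⟩
  rw [pathBody, Cmd.exec_seq_of_next hnext]
  simp only [Cmd.exec, Test.Holds, RealExpr.eval, Nat.cast_zero, Nat.cast_one]
  split_ifs with hi hfail <;> grind

variable {s e : Fin k → ℝ}

theorem entry_withDummy_energy (s e : Fin k → ℝ) (i : Fin k) :
    entry (withDummy s e).energy (i + 1) = e i := by
  rw [entry, dif_pos ⟨by omega, by omega⟩]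
  exact Fin.snoc_castSucc (α := fun _ => ℝ) 0 e i

theorem entry_withDummy_pos (s e : Fin k → ℝ) {j : ℕ} (hj : j ≤ k) :
    entry (withDummy s e).pos (j + 1) = station s j := by
  rw [entry, dif_pos ⟨by omega, by omega⟩, station]
  split_ifs with h
  · exact Fin.snoc_castSucc (α := fun _ => ℝ) 1 s ⟨j, h⟩
  · obtain rfl : j = k := by omega
    exact Fin.snoc_last (α := fun _ => ℝ) 1 s

open Classical in
theorem Reach.exists_exec (hmono : Monotone s) (hs : ∀ i, s i ∈ Set.Icc (0 : ℝ) 1)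
    (he : ∀ i, 0 ≤ e i) {i : Fin k} (h : Reach s e i l tr) :
    ∃ l' tr', Reach s e (i + 1) l' tr' ∧
      (pathBody.exec (withDummy s e) (i + 1) (initStore l tr)).1 =
        if (i : ℕ) + 1 < k then .call l' tr' else .ret (decide (1 ≤ l' ∧ 0 ≤ tr')) := by
  have hpos := entry_withDummy_pos s e i.2.le
  have hnext := entry_withDummy_pos s e i.2
  have henergy := entry_withDummy_energy s e i
  rw [station_coe] at hpos
  obtain ⟨l', tr', hadv, hexec⟩ := exists_exec_pathBody (I := withDummy s e) (i := i + 1)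
    (l := l) (tr := tr)
    (by rw [hpos, hnext]; exact le_station_succ hmono (fun i => (hs i).2) i)
    (by rw [henergy]; exact he i)
  rw [hpos, hnext, henergy] at hadv
  exact ⟨l', tr', h.succ hadv, hexec⟩

theorem Reach.exists_returns {C : ℕ}
    (hC : ∀ (I : Input k) (i : ℕ) (σ : Var → ℝ), (pathBody.exec I i σ).2 ≤ C)
    (hmono : Monotone s) (hs : ∀ i, s i ∈ Set.Icc (0 : ℝ) 1) (he : ∀ i, 0 ≤ e i) {j m : ℕ}
    (h : Reach s e j l tr) (hjm : j + m + 1 = k) :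
    ∃ r t, Returns pathBody (withDummy s e) (j + 1) l tr r t ∧ t ≤ C * (m + 1) ∧
      ∃ l' tr', Reach s e k l' tr' ∧ (r = true ↔ 1 ≤ l' ∧ 0 ≤ tr') := by
  induction m generalizing j l tr with
  | zero =>
    obtain ⟨l', tr', hreach, hexec⟩ := exists_exec (i := ⟨j, by omega⟩) hmono hs he h
    rw [if_neg (by simp only; omega)] at hexec
    obtain rfl : j + 1 = k := hjm
    exact ⟨_, _, .ret _ _ _ _ _ (Prod.ext hexec rfl), (hC _ _ _).trans (by simp), l', tr', hreach,
      decide_eq_true_iff⟩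
  | succ m ih =>
    obtain ⟨l', tr', hreach, hexec⟩ := exists_exec (i := ⟨j, by omega⟩) hmono hs he h
    rw [if_pos (by simp only; omega)] at hexec
    obtain ⟨r, t, hret, ht, hfinal⟩ := ih hreach (by simp only; omega)
    exact ⟨r, _, .call _ _ _ _ _ _ _ _ (Prod.ext hexec rfl) hret,
      (add_le_add (hC _ _ _) ht).trans_eq (by ring), hfinal⟩

end Execution

end SegmentExploration

theorem mainTheorem1 :
    ∃ C : ℕ, ∀ (k : ℕ), 1 ≤ k → ∀ (s e : Fin k → ℝ),
      Monotone s → (∀ i, s i ∈ Set.Icc (0 : ℝ) 1) → (∀ i, 0 ≤ e i) →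
      ∃ (solvable : Bool) (t : ℕ),
        SegmentExploration.Returns SegmentExploration.pathBody
          (SegmentExploration.withDummy s e) 1 0 0 solvable t ∧
        t ≤ C * k ∧
        (solvable = true ↔
          ∃ T : Fin k → SegmentExploration.Trajectory k,
            SegmentExploration.Valid s e T ∧ SegmentExploration.Explores s T) := by
  obtain ⟨C, hC⟩ := SegmentExploration.pathBody.exists_time_le
  refine ⟨C, fun k hk s e hmono hs he => ?_⟩
  obtain ⟨r, t, hret, ht, l, tr, hreach, hiff⟩ :=
    SegmentExploration.Reach.exists_returns (hC k) hmono hs he .zero (m := k - 1) (by omega)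
  rw [Nat.sub_add_cancel hk] at ht
  exact ⟨r, t, hret, ht, hiff.trans ⟨fun h => hreach.exists_explores hmono hs he h.1 h.2,
    fun ⟨_, hvalid, hexp⟩ => hreach.one_le_and_nonneg_of_explores hmono hs he hvalid hexp⟩⟩
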